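/- **Setting.** Fix a set of values $\mathbb V$ containing two distinct values $\mathit{true},\mathit{false}$, function symbols with a fixed interpretation over $\mathbb V$ that include $=,\vee,\neg$ with their usual meaning, a finite set $\mathbb I$ of inputs, a set $\mathbb C$ of cells, and an initial assignment $\zeta_{-1}:\mathbb I\cup\mathbb C\to\mathbb V$. Function terms $\tau$ are built from inputs, cells and function symbols; predicate terms are function terms that only evaluate to $\mathit{true}$ or $\mathit{false}$. A computation is a sequence $\zeta=\zeta_0\zeta_1\cdots$ of assignments. Basic statements are $\mathit{assert}(\tau_P)$ ($\tau_P$ a predicate term), $c:=\tau$, $c:=*$; statements are finite sequences of basic ones. $\zeta$ *matches* a sequence $\sigma$ of basic statements if for all $t\ge 0$: if $\sigma_t=\mathit{assert}(\tau_P)$, then $\tau_P$ is true in $\zeta_{t-1}$ and no cell changes from $\zeta_{t-1}$ to $\zeta_t$; if $\sigma_t=(c:=\tau)$, then $\zeta_t(c)$ is the value of $\tau$ in $\zeta_{t-1}$ and no other cell changes; if $\sigma_t=(c:=*)$, then no cell other than $c$ changes. $\zeta$ matches a sequence of composed statements if it matches the flattened sequence and, a composed statement being one time step of the system, the inputs change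 only at the last basic statement of each composed statement. A sequence of statements is *feasible* if some computation matches it. A *program automaton* $P$ is a Büchi automaton with basic statements as letters and all states accepting; its executions are the computations matching a word accepted by $P$. A HyperTSL(T) formula $\varphi=\forall\pi_1\cdots\forall\pi_m\exists\pi_{m+1}\cdots\exists\pi_n.\,\psi$ ($m\le n$) has a body $\psi$ built with $\neg,\wedge,\bigcirc,\mathcal U$ from predicate terms and update terms $[\![c_\pi\leftarrow\tau]\!]$ over the indexed inputs $\mathbb I\times\{\pi_1,\dots,\pi_n\}$ and cells $\mathbb C\times\{\pi_1,\dots,\pi_n\}$; at time $t$ the update term says that $c_\pi$ now has the value that $\tau$ had at time $t-1$ (where time $-1$ is $\zeta_{-1}$ on each trace). $P$ *satisfies* $\varphi$ if $\varphi$ holds at time $0$ with the quantifiers ranging over the executions of $P$. **Construction.** Let $A_\psi$ be a Büchi automaton over the subsets of the set of predicate terms $\rho$ and update terms $\upsilon=\{[\![c_1\leftarrow\tau_1]\!],\dots,[\![c_r\leftarrow\tau_r]\!]\}$ of $\psi$, accepting exactly the words that satisfy $\psi$ read as an LTL formula over these terms as atomic propositions. * $P^n$ is the $n$-fold self-composition: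 states are $n$-tuples, and from transitions $(q_i,s_i,q_i')$ of $P$ one gets a transition from $(q_i)_i$ to $(q_i')_i$ labelled $(s_1)_{\pi_1};\dots;(s_n)_{\pi_n}$, where $(s)_\pi$ indexes all inputs and cells of $s$ by $\pi$; all states are accepting. * For a label $l\subseteq\rho\cup\upsilon$, $\mathit{combine}(s,l)$ is the statement $\mathit{tmp}_1:=\tau_1;\dots;\mathit{tmp}_r:=\tau_r;\ s;\ i:=*$ (for every indexed input $i$)$;\ \mathit{assert}(h_1);\ \mathit{assert}(h_2)$, over the cells consisting of the indexed cells, the indexed inputs and fresh $\mathit{tmp}_j$ (and without inputs), where $h_1$ is the conjunction of the predicate terms in $l$ and the negations of those in $\rho\setminus l$, and $h_2$ is the conjunction of $c_j=\mathit{tmp}_j$ for update terms in $l$ and $c_j\ne\mathit{tmp}_j$ for the others. $P^n\otimes A_\psi$ is the product automaton with transitions $((p,q),\mathit{combine}(s,l),(p',q'))$, accepting when the second component is. * For $k\in\mathbb N$, $B_k$ is the automaton obtained from $B=P^n\otimes A_\psi$ by remembering the last $k-1$ transitions (all previous ones if there are fewer) and keeping a transition only if the remembered statements followed by the new one, followed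 by $\mathit{assert}(\mathit{true})^\omega$, are feasible for some initial assignment ($B_0=B$). * An *infeasible accepting cycle* of an automaton is a cyclic sequence of transitions $(q_1,s_1,q_2)\cdots(q_{\ell},s_{\ell},q_1)$ that contains an accepting state and for which $(s_1\cdots s_\ell)^\omega$ is infeasible for every initial assignment. In one round one chooses a set $C$ of infeasible accepting cycles of the current automaton and replaces that automaton by an automaton for its language minus the words that end with $(s_1\cdots s_\ell)^\omega$ for some cycle in $C$. Let $(P^n\otimes A_\psi)_{k,C(k')}$ be any result of $k'$ such rounds from $(P^n\otimes A_\psi)_k$. * $(P^n\otimes A_\psi)^\forall_{k,C(k')}$ has the same states, initial state and accepting states, and it has a transition from $q$ to $q'$ labelled $(s_1)_{\pi_1};\dots;(s_m)_{\pi_m}$ whenever, for some $s_{m+1},\dots,s_n$ and $l$, $(P^n\otimes A_\psi)_{k,C(k')}$ has a transition from $q$ to $q'$ labelled $\mathit{combine}((s_1)_{\pi_1};\dots;(s_n)_{\pi_n},\,l)$. **Theorem.** For all $k,k'\in\mathbb N$ and $m\le n$: if some word accepted by $P^m$ and not accepted by $(P^n\otimes A_\psi)^\forall_{k,C(k')}$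 is feasible (from $\zeta_{-1}$ on each trace), i.e. if $P^m\setminus(P^n\otimes A_\psi)^\forall_{k,C(k')}$ has a feasible trace, then $P$ does not satisfy $\varphi$. -/

import Mathlib

universe u v

/-! ### Büchi automata -/

/-- A Büchi automaton over the alphabet `S`. -/
structure Buchi (S : Type v) where
  Q : Type u
  init : Q
  trans : Set (Q × S × Q)
  acc : Set Q

/-- The infinite words with a run from the initial state that visits accepting states infinitely
often. -/
def Buchi.language {S : Type v} (A : Buchi.{u} S) : Set (ℕ → S) :=
  {x | ∃ r : ℕ → A.Q, r 0 = A.init ∧ (∀ t, (r t, x t, r (t + 1)) ∈ A.trans) ∧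
    {t | r t ∈ A.acc}.Infinite}

/-! ### Theories, terms, assignments -/

/-- A set of values with two distinguished truth values, and interpreted function symbols that
contain equality, disjunction and negation with their usual interpretation. -/
structure Theory where
  V : Type u
  tt : V
  ff : V
  tt_ne_ff : tt ≠ ff
  /-- function symbols, by arity -/
  F : ℕ → Type u
  interp : {n : ℕ} → F n → (Fin n → V) → V
  eqSymb : F 2
  orSymb : F 2
  notSymb : F 1
  interp_eq_self : ∀ a, interp eqSymb ![a, a] = tt
  interp_eq_ne : ∀ a b, a ≠ b → interp eqSymb ![a, b] = ff
  interp_or_tt_tt : interp orSymb ![tt, tt] = tt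
  interp_or_tt_ff : interp orSymb ![tt, ff] = tt
  interp_or_ff_tt : interp orSymb ![ff, tt] = tt
  interp_or_ff_ff : interp orSymb ![ff, ff] = ff
  interp_not_tt : interp notSymb ![tt] = ff
  interp_not_ff : interp notSymb ![ff] = tt

/-- Function terms over the variables `X`. For inputs `I` and cells `C` one takes `X = I ⊕ C`. -/
inductive Term (T : Theory.{u}) (X : Type u) : Type u where
  | var (x : X) : Term T X
  | app {n : ℕ} (f : T.F n) (args : Fin n → Term T X) : Term T X

/-- Assignments of values to variables. -/
abbrev Assignment (T : Theory.{u}) (X : Type u) : Type u := X → T.V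

/-- The evaluation function. -/
def Term.eval {T : Theory.{u}} {X : Type u} (a : Assignment T X) : Term T X → T.V
  | .var x => a x
  | .app f args => T.interp f fun i => (args i).eval a

/-- Renaming of variables. -/
def Term.map {T : Theory.{u}} {X Y : Type u} (g : X → Y) : Term T X → Term T Y
  | .var x => .var (g x)
  | .app f args => .app f fun i => (args i).map g

theorem Term.eval_map {T : Theory.{u}} {X Y : Type u} (g : X → Y) (a : Assignment T Y)
    (τ : Term T X) : (τ.map g).eval a = τ.eval (fun x => a (g x)) := by
  induction τ with
  | var x => rfl
  | app f args ih => simp only [Term.map, Term.eval, ih]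

/-- Predicate terms: function terms that evaluate only to `tt` or `ff`. -/
def PredTerm (T : Theory.{u}) (X : Type u) : Type u :=
  {τ : Term T X // ∀ a, τ.eval a = T.tt ∨ τ.eval a = T.ff}

namespace PredTerm

variable {T : Theory.{u}} {X Y : Type u}

def map (g : X → Y) (p : PredTerm T X) : PredTerm T Y :=
  ⟨p.1.map g, fun a => by rw [Term.eval_map]; exact p.2 _⟩

/-- The predicate term `σ = τ`. -/
def eq (σ τ : Term T X) : PredTerm T X :=
  ⟨.app T.eqSymb ![σ, τ], fun a => by
    have h : (fun i => ((![σ, τ] : Fin 2 → Term T X) i).eval a) = ![σ.eval a, τ.eval a] := by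
      funext i; fin_cases i <;> rfl
    simp only [Term.eval, h]
    by_cases e : σ.eval a = τ.eval a
    · left; rw [e]; exact T.interp_eq_self _
    · right; exact T.interp_eq_ne _ _ e⟩

def not (p : PredTerm T X) : PredTerm T X :=
  ⟨.app T.notSymb ![p.1], fun a => by
    have h : (fun i => ((![p.1] : Fin 1 → Term T X) i).eval a) = ![p.1.eval a] := by
      funext i; fin_cases i; rfl
    simp only [Term.eval, h]
    rcases p.2 a with e | e <;> rw [e]
    · right; exact T.interp_not_tt
    · left; exact T.interp_not_ff⟩

def or (p q : PredTerm T X) : PredTerm T X :=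
  ⟨.app T.orSymb ![p.1, q.1], fun a => by
    have h : (fun i => ((![p.1, q.1] : Fin 2 → Term T X) i).eval a) =
        ![p.1.eval a, q.1.eval a] := by
      funext i; fin_cases i <;> rfl
    simp only [Term.eval, h]
    rcases p.2 a with e | e <;> rcases q.2 a with e' | e' <;> rw [e, e']
    · left; exact T.interp_or_tt_tt
    · left; exact T.interp_or_tt_ff
    · left; exact T.interp_or_ff_tt
    · right; exact T.interp_or_ff_ff⟩

def and (p q : PredTerm T X) : PredTerm T X := (p.not.or q.not).not

/-- Finite conjunction; `top` is the value of the empty conjunction. -/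
def conj (top : PredTerm T X) (l : List (PredTerm T X)) : PredTerm T X := l.foldr and top

end PredTerm

/-! ### Temporal formulas -/

/-- Linear temporal formulas over the atoms `AP`. -/
inductive LTL (AP : Type u) : Type u where
  | atom (a : AP) : LTL AP
  | not (φ : LTL AP) : LTL AP
  | and (φ ψ : LTL AP) : LTL AP
  | next (φ : LTL AP) : LTL AP
  | untl (φ ψ : LTL AP) : LTL AP

/-- `holds t a` says that the atom `a` is true at time `t`. -/
def LTL.Sat {AP : Type u} (holds : ℕ → AP → Prop) : ℕ → LTL AP → Prop
  | t, .atom a => holds t a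
  | t, .not φ => ¬ LTL.Sat holds t φ
  | t, .and φ ψ => LTL.Sat holds t φ ∧ LTL.Sat holds t ψ
  | t, .next φ => LTL.Sat holds (t + 1) φ
  | t, .untl φ ψ => ∃ t', t ≤ t' ∧ LTL.Sat holds t' ψ ∧
      ∀ t'', t ≤ t'' → t'' < t' → LTL.Sat holds t'' φ

def LTL.atoms {AP : Type u} : LTL AP → List AP
  | .atom a => [a]
  | .not φ => φ.atoms
  | .and φ ψ => φ.atoms ++ ψ.atoms
  | .next φ => φ.atoms
  | .untl φ ψ => φ.atoms ++ ψ.atoms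

/-- The atoms of TSL(T): predicate terms, and update terms `⟦c ↢ τ⟧` given as pairs `(c, τ)`. -/
abbrev Atom (T : Theory.{u}) (I C : Type u) : Type u :=
  PredTerm T (I ⊕ C) ⊕ (C × Term T (I ⊕ C))

/-- TSL(T) formulas. The same tree, read over words of sets of atoms, is the LTL formula obtained
by treating predicate and update terms as atomic propositions. -/
abbrev TSL (T : Theory.{u}) (I C : Type u) : Type u := LTL (Atom T I C)

/-- The assignment one step before time `t`; it is the initial assignment for `t = 0`. -/
def prev {A : Type u} (init : A) (ζ : ℕ → A) : ℕ → A
  | 0 => init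
  | t + 1 => ζ t

/-- Truth of an atom at time `t` in the computation `ζ`. -/
def Atom.Holds {T : Theory.{u}} {I C : Type u} (init : Assignment T (I ⊕ C))
    (ζ : ℕ → Assignment T (I ⊕ C)) (t : ℕ) : Atom T I C → Prop
  | .inl p => p.1.eval (ζ t) = T.tt
  | .inr (c, τ) => τ.eval (prev init ζ t) = ζ t (.inr c)

def TSL.Sat {T : Theory.{u}} {I C : Type u} (init : Assignment T (I ⊕ C))
    (ζ : ℕ → Assignment T (I ⊕ C)) (t : ℕ) (φ : TSL T I C) : Prop :=
  LTL.Sat (Atom.Holds init ζ) t φ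

/-! ### HyperTSL(T) -/

/-- HyperTSL(T) formulas with trace variables `Fin n`: a quantifier prefix in front of a formula
whose inputs and cells are indexed by trace variables. -/
inductive HyperTSL (T : Theory.{u}) (I C : Type u) (n : ℕ) : Type u where
  | body (ψ : TSL T (I × Fin n) (C × Fin n)) : HyperTSL T I C n
  | all (π : Fin n) (φ : HyperTSL T I C n) : HyperTSL T I C n
  | ex (π : Fin n) (φ : HyperTSL T I C n) : HyperTSL T I C n

/-- The hyper-assignment that gives every trace the assignment `a`. -/
def hyperInit {T : Theory.{u}} {I C : Type u} (n : ℕ) (a : Assignment T (I ⊕ C)) :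
    Assignment T ((I × Fin n) ⊕ (C × Fin n))
  | .inl (i, _) => a (.inl i)
  | .inr (c, _) => a (.inr c)

/-- The extension `h[π, ζ]` of a hyper-computation. -/
def extend {T : Theory.{u}} {I C : Type u} {n : ℕ}
    (h : ℕ → Assignment T ((I × Fin n) ⊕ (C × Fin n))) (π : Fin n)
    (ζ : ℕ → Assignment T (I ⊕ C)) : ℕ → Assignment T ((I × Fin n) ⊕ (C × Fin n))
  | t, .inl (i, π') => if π' = π then ζ t (.inl i) else h t (.inl (i, π'))
  | t, .inr (c, π') => if π' = π then ζ t (.inr c) else h t (.inr (c, π'))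

/-- Satisfaction at time 0 with respect to a set `Z` of computations. -/
def HyperTSL.Sat {T : Theory.{u}} {I C : Type u} {n : ℕ} (init : Assignment T (I ⊕ C))
    (Z : Set (ℕ → Assignment T (I ⊕ C))) :
    (ℕ → Assignment T ((I × Fin n) ⊕ (C × Fin n))) → HyperTSL T I C n → Prop
  | h, .body ψ => TSL.Sat (hyperInit n init) h 0 ψ
  | h, .all π φ => ∀ ζ ∈ Z, HyperTSL.Sat init Z (extend h π ζ) φ
  | h, .ex π φ => ∃ ζ ∈ Z, HyperTSL.Sat init Z (extend h π ζ) φ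

/-- `Z ⊨ φ`. The hyper-computation one starts with is immaterial for closed formulas: every trace
variable that is used is overwritten by its quantifier. -/
def HyperTSL.Models {T : Theory.{u}} {I C : Type u} {n : ℕ} (init : Assignment T (I ⊕ C))
    (Z : Set (ℕ → Assignment T (I ⊕ C))) (φ : HyperTSL T I C n) : Prop :=
  HyperTSL.Sat init Z (fun _ => hyperInit n init) φ

/-- `∀ π₁ … ∀ πₘ ∃ πₘ₊₁ … ∃ πₙ. ψ` (the trace variable `πⱼ` is `j - 1 : Fin n`). -/
def forallExists {T : Theory.{u}} {I C : Type u} (m n : ℕ)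
    (ψ : TSL T (I × Fin n) (C × Fin n)) : HyperTSL T I C n :=
  (List.finRange n).foldr (fun π φ => if π.val < m then .all π φ else .ex π φ) (.body ψ)

/-! ### Program statements -/

/-- Basic program statements over the inputs `I` and the cells `C`. -/
inductive BasicStmt (T : Theory.{u}) (I C : Type u) : Type u where
  | assert (p : PredTerm T (I ⊕ C)) : BasicStmt T I C
  | assign (c : C) (τ : Term T (I ⊕ C)) : BasicStmt T I C
  | havoc (c : C) : BasicStmt T I C

/-- Program statements `s₁; …; sₗ`, as the sequence of their basic statements. -/
abbrev Stmt (T : Theory.{u}) (I C : Type u) : Type u := List (BasicStmt T I C)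

/-- Renaming of the variables of a statement: cells by `gC`, all variables in terms by `g`. -/
def BasicStmt.map {T : Theory.{u}} {I C I' C' : Type u} (g : I ⊕ C → I' ⊕ C') (gC : C → C') :
    BasicStmt T I C → BasicStmt T I' C'
  | .assert p => .assert (p.map g)
  | .assign c τ => .assign (gC c) (τ.map g)
  | .havoc c => .havoc (gC c)

/-- `(s)_π`: every cell `c` becomes `c_π` and every input `i` becomes `i_π`. -/
def BasicStmt.index {T : Theory.{u}} {I C : Type u} {n : ℕ} (π : Fin n) (s : BasicStmt T I C) :
    BasicStmt T (I × Fin n) (C × Fin n) :=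
  s.map (Sum.map (fun i => (i, π)) (fun c => (c, π))) (fun c => (c, π))

/-- Executing `s` may lead from the assignment `a` to the assignment `b`. -/
def BasicStmt.Step {T : Theory.{u}} {I C : Type u} (a b : Assignment T (I ⊕ C)) :
    BasicStmt T I C → Prop
  | .assert p => p.1.eval a = T.tt ∧ ∀ c, b (.inr c) = a (.inr c)
  | .assign c τ => τ.eval a = b (.inr c) ∧ ∀ c', c' ≠ c → b (.inr c') = a (.inr c')
  | .havoc c => ∀ c', c' ≠ c → b (.inr c') = a (.inr c')

/-- The computation `ζ` matches the trace `σ` of basic statements. -/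
def MatchesBasic {T : Theory.{u}} {I C : Type u} (init : Assignment T (I ⊕ C))
    (ζ : ℕ → Assignment T (I ⊕ C)) (σ : ℕ → BasicStmt T I C) : Prop :=
  ∀ t, (σ t).Step (prev init ζ t) (ζ t)

/-- The position in the flattened trace at which the statement `σ t` starts. -/
def blockStart {T : Theory.{u}} {I C : Type u} (σ : ℕ → Stmt T I C) (t : ℕ) : ℕ :=
  ∑ s ∈ Finset.range t, (σ s).length

/-- The computation `ζ` matches the trace `σ` of statements: `ζ` matches the flattened trace, whose
entry at position `blockStart σ t + j` is the `j`-th basic statement of `σ t`. A composed statement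
takes one time step of the system, so new input values arrive only with its last basic statement. -/
def Matches {T : Theory.{u}} {I C : Type u} (init : Assignment T (I ⊕ C))
    (ζ : ℕ → Assignment T (I ⊕ C)) (σ : ℕ → Stmt T I C) : Prop :=
  ∀ (t j : ℕ) (h : j < (σ t).length),
    ((σ t)[j]).Step (prev init ζ (blockStart σ t + j)) (ζ (blockStart σ t + j)) ∧
    (j + 1 < (σ t).length → ∀ i : I,
      ζ (blockStart σ t + j) (.inl i) = prev init ζ (blockStart σ t + j) (.inl i))

def Feasible {T : Theory.{u}} {I C : Type u} (init : Assignment T (I ⊕ C))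
    (σ : ℕ → Stmt T I C) : Prop :=
  ∃ ζ, Matches init ζ σ

/-- The executions of a program automaton. -/
def executions {T : Theory.{u}} {I C : Type u} (init : Assignment T (I ⊕ C))
    (P : Buchi.{u} (BasicStmt T I C)) : Set (ℕ → Assignment T (I ⊕ C)) :=
  {ζ | ∃ σ ∈ P.language, MatchesBasic init ζ σ}

/-- A program automaton satisfies a HyperTSL(T) formula. -/
def Satisfies {T : Theory.{u}} {I C : Type u} {n : ℕ} (init : Assignment T (I ⊕ C))
    (P : Buchi.{u} (BasicStmt T I C)) (φ : HyperTSL T I C n) : Prop :=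
  HyperTSL.Models init (executions init P) φ

/-- The `n`-fold self-composition of a program automaton. -/
def selfComp {T : Theory.{u}} {I C : Type u} (n : ℕ) (P : Buchi.{u} (BasicStmt T I C)) :
    Buchi.{u} (Stmt T (I × Fin n) (C × Fin n)) where
  Q := Fin n → P.Q
  init := fun _ => P.init
  trans := {x | ∃ s : Fin n → BasicStmt T I C, (∀ i, (x.1 i, s i, x.2.2 i) ∈ P.trans) ∧
    x.2.1 = List.ofFn fun i => (s i).index i}
  acc := Set.univ

/-! ### The combined product -/

/-- Transition labels: subsets of the atoms that appear in `ψ`. -/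
abbrev Label {T : Theory.{u}} {I C : Type u} (ψ : TSL T I C) : Type u :=
  {l : Set (Atom T I C) // ∀ a ∈ l, a ∈ ψ.atoms}

/-- `A` is a Büchi automaton for `ψ`: it accepts the words of labels that satisfy `ψ` when its
predicate and update terms are treated as atomic propositions. -/
def IsAutomatonFor {T : Theory.{u}} {I C : Type u} {ψ : TSL T I C} (A : Buchi.{u} (Label ψ)) :
    Prop :=
  A.language = {x | LTL.Sat (fun t a => a ∈ (x t).1) 0 ψ}

/-- The cells `ℂ* = ℂ ∪ 𝕀 ∪ {tmp₀, tmp₁, …}`. -/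
inductive StarCell (I C : Type u) : Type u where
  | cell (c : C) : StarCell I C
  | input (i : I) : StarCell I C
  | tmp (j : ℕ) : StarCell I C

/-- Statements over the cells `ℂ*`, without inputs. -/
abbrev StarStmt (T : Theory.{u}) (I C : Type u) : Type u := Stmt T PEmpty.{u + 1} (StarCell I C)

/-- The variables of a term, read as cells of `ℂ*`. -/
def toStar {I C : Type u} : I ⊕ C → PEmpty.{u + 1} ⊕ StarCell I C
  | .inl i => .inr (.input i)
  | .inr c => .inr (.cell c)

/-- The cell `c` of `ℂ*` as a term. -/
def starVar (T : Theory.{u}) {I C : Type u} (c : StarCell I C) :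
    Term T (PEmpty.{u + 1} ⊕ StarCell I C) :=
  .var (.inr c)

/-- The predicate term *true*. -/
def starTrue (T : Theory.{u}) (I C : Type u) : PredTerm T (PEmpty.{u + 1} ⊕ StarCell I C) :=
  .eq (starVar T (.tmp 0)) (starVar T (.tmp 0))

open Classical in
/-- The predicate terms that appear in `ψ`, without repetition. -/
noncomputable def preds {T : Theory.{u}} {I C : Type u} (ψ : TSL T I C) :
    List (PredTerm T (I ⊕ C)) :=
  (ψ.atoms.filterMap Sum.getLeft?).dedup

open Classical in
/-- The update terms that appear in `ψ`, without repetition. -/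
noncomputable def updates {T : Theory.{u}} {I C : Type u} (ψ : TSL T I C) :
    List (C × Term T (I ⊕ C)) :=
  (ψ.atoms.filterMap Sum.getRight?).dedup

noncomputable def saveValues {T : Theory.{u}} {I C : Type u} (ψ : TSL T I C) : StarStmt T I C :=
  (updates ψ).zipIdx.map fun x => .assign (.tmp x.2) (x.1.2.map toStar)

noncomputable def newInputs (T : Theory.{u}) (I C : Type u) [Fintype I] : StarStmt T I C :=
  (Finset.univ : Finset I).toList.map fun i => .havoc (.input i)

open Classical in
noncomputable def checkPreds {T : Theory.{u}} {I C : Type u} {ψ : TSL T I C} (l : Label ψ) :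
    PredTerm T (PEmpty.{u + 1} ⊕ StarCell I C) :=
  .conj (starTrue T I C)
    (((preds ψ).filter fun p => .inl p ∈ l.1).map (fun p => p.map toStar) ++
      ((preds ψ).filter fun p => .inl p ∉ l.1).map (fun p => (p.map toStar).not))

open Classical in
noncomputable def checkUpdates {T : Theory.{u}} {I C : Type u} {ψ : TSL T I C} (l : Label ψ) :
    PredTerm T (PEmpty.{u + 1} ⊕ StarCell I C) :=
  .conj (starTrue T I C) ((updates ψ).zipIdx.map fun x =>
    if .inr x.1 ∈ l.1 then .eq (starVar T (.cell x.1.1)) (starVar T (.tmp x.2))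
    else (PredTerm.eq (starVar T (.cell x.1.1)) (starVar T (.tmp x.2))).not)

/-- `combine(s, l)`. -/
noncomputable def combine {T : Theory.{u}} {I C : Type u} [Fintype I] {ψ : TSL T I C}
    (s : Stmt T I C) (l : Label ψ) : StarStmt T I C :=
  saveValues ψ ++ s.map (fun b => b.map toStar .cell) ++ newInputs T I C ++
    [.assert (checkPreds l)] ++ [.assert (checkUpdates l)]

/-- The combined product `P ⊗ A`. -/
noncomputable def combinedProduct {T : Theory.{u}} {I C : Type u} [Fintype I] {ψ : TSL T I C}
    (P : Buchi.{u} (Stmt T I C)) (A : Buchi.{u} (Label ψ)) : Buchi.{u} (StarStmt T I C) where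
  Q := P.Q × A.Q
  init := (P.init, A.init)
  trans := {x | ∃ s l, (x.1.1, s, x.2.2.1) ∈ P.trans ∧ (x.1.2, l, x.2.2.2) ∈ A.trans ∧
    x.2.1 = combine s l}
  acc := {q | q.2 ∈ A.acc}

/-! ### Removing `k`-infeasibility -/

/-- The finite sequence `w` of statements is feasible: `w; assert(true)^ω` is feasible for some
initial assignment. -/
def FeasibleSeq {T : Theory.{u}} {I C : Type u} (w : List (StarStmt T I C)) : Prop :=
  ∃ init, Feasible init fun t => w.getD t [.assert (starTrue T I C)]

/-- `(q, [(s₁, q₁), …, (sₗ, qₗ)])` stands for the sequence `q s₁ q₁ … sₗ qₗ`. -/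
abbrev PathSeq (Q S : Type u) : Type u := Q × List (S × Q)

/-- The last state of the sequence. -/
def PathSeq.last {Q S : Type u} (p : PathSeq Q S) : Q := (p.2.map Prod.snd).getLastD p.1

/-- The statements of the sequence. -/
def PathSeq.labels {Q S : Type u} (p : PathSeq Q S) : List S := p.2.map Prod.fst

/-- The sequence extended by `s` and `q` at its end. -/
def PathSeq.snoc {Q S : Type u} (p : PathSeq Q S) (s : S) (q : Q) : PathSeq Q S :=
  (p.1, p.2 ++ [(s, q)])

/-- The sequence without its first state and first statement. -/
def PathSeq.tail {Q S : Type u} : PathSeq Q S → PathSeq Q S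
  | (q, []) => (q, [])
  | (_, (_, q') :: l) => (q', l)

/-- All triples of the sequence are transitions of `A`. -/
def IsPath {S : Type u} (A : Buchi.{u} S) : A.Q → List (S × A.Q) → Prop
  | _, [] => True
  | q, (s, q') :: l => (q, s, q') ∈ A.trans ∧ IsPath A q' l

/-- The automaton `A_k` without `k`-infeasibility. It remembers the `k - 1` previous statements, or
all previous ones if there are fewer. There is nothing to remove for `k = 0`. -/
def removeInfeasible {T : Theory.{u}} {I C : Type u} (A : Buchi.{u} (StarStmt T I C)) :
    ℕ → Buchi.{u} (StarStmt T I C)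
  | 0 => A
  | K + 1 =>
    { Q := {p : PathSeq A.Q (StarStmt T I C) // IsPath A p.1 p.2 ∧
        (p.2.length = K ∨ (p.2.length < K ∧ p.1 = A.init))}
      init := ⟨(A.init, []), trivial, (Nat.eq_zero_or_pos K).imp Eq.symm fun h => ⟨h, rfl⟩⟩
      trans := {x | ∃ q, (x.1.1.last, x.2.1, q) ∈ A.trans ∧
        FeasibleSeq (x.1.1.labels ++ [x.2.1]) ∧
        ((x.1.1.2.length = K ∧ x.2.2.1 = (x.1.1.snoc x.2.1 q).tail) ∨
         (x.1.1.2.length < K ∧ x.2.2.1 = x.1.1.snoc x.2.1 q))}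
      acc := {p | p.1.last ∈ A.acc} }

/-! ### Removing infeasible accepting cycles -/

/-- A cyclic sequence of `len + 1` triples `(state j, label j, state (j + 1))`; addition in
`Fin (len + 1)` is cyclic. -/
structure CycleSeq (Q S : Type u) where
  len : ℕ
  state : Fin (len + 1) → Q
  label : Fin (len + 1) → S

/-- The word `(s₁ s₂ … sₗ)^ω` of the labels of the cycle. -/
def CycleSeq.word {Q S : Type u} (c : CycleSeq Q S) : ℕ → S := fun t => c.label (Fin.ofNat _ t)

/-- Infeasible accepting cycles of `A`. -/
def IsInfeasibleAcceptingCycle {T : Theory.{u}} {I C : Type u} (A : Buchi.{u} (StarStmt T I C))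
    (c : CycleSeq A.Q (StarStmt T I C)) : Prop :=
  (∀ j, (c.state j, c.label j, c.state (j + 1)) ∈ A.trans) ∧
  (∃ j, c.state j ∈ A.acc) ∧
  ∀ init, ¬ Feasible init c.word

/-- The automaton of a cycle, which accepts the words that end with `c.word`. The state `none` is
its fresh initial state, `some j` is the `j`-th state of the cycle. -/
def cycleAutomaton {Q S : Type u} (c : CycleSeq Q S) : Buchi.{0} S where
  Q := Option (Fin (c.len + 1))
  init := none
  trans := {x | (x.1 = none ∧ x.2.2 = none) ∨
    (∃ j, x = (some j, c.label j, some (j + 1))) ∨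
    x = (none, c.label 0, some (0 + 1))}
  acc := {q | q ≠ none}

/-- `CyclesRemoved r A B`: the automaton `B` results from `A` by `r` rounds. A round picks a set
`S` of infeasible accepting cycles of the current automaton `B`, and goes over to an automaton `D`
for the difference of `B` and the union of the automata of these cycles. -/
inductive CyclesRemoved {T : Theory.{u}} {I C : Type u} :
    ℕ → Buchi.{u} (StarStmt T I C) → Buchi.{u} (StarStmt T I C) → Prop where
  | zero (A : Buchi.{u} (StarStmt T I C)) : CyclesRemoved 0 A A
  | succ (r : ℕ) (A B D : Buchi.{u} (StarStmt T I C))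
      (S : Set (CycleSeq B.Q (StarStmt T I C))) (h : CyclesRemoved r A B)
      (hS : ∀ c ∈ S, IsInfeasibleAcceptingCycle B c)
      (hD : D.language = B.language \ ⋃ c ∈ S, (cycleAutomaton c).language) :
      CyclesRemoved (r + 1) A D

/-! ### Universal projection -/

/-- The projection of an automaton over combined statements of `n` program copies to the first `m`
copies. -/
noncomputable def projectUniversal {T : Theory.{u}} {I C : Type u} [Fintype I] {m n : ℕ}
    (hmn : m ≤ n) (ψ : TSL T (I × Fin n) (C × Fin n))
    (B : Buchi.{u} (StarStmt T (I × Fin n) (C × Fin n))) :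
    Buchi.{u} (Stmt T (I × Fin m) (C × Fin m)) where
  Q := B.Q
  init := B.init
  trans := {x | ∃ (s : Fin n → BasicStmt T I C) (l : Label ψ),
    (x.1, combine (List.ofFn fun i => (s i).index i) l, x.2.2) ∈ B.trans ∧
    x.2.1 = List.ofFn fun i : Fin m => (s (Fin.castLE hmn i)).index i}
  acc := B.acc

/-!
The argument is by contradiction. Suppose that `P` satisfies the formula, and let `σ` be a feasible
trace of the self-composition `P^m`. Sampling a matching computation at the ends of the composed
statements yields `m` executions of `P` (`exists_matchesBasic_of_feasible`): only one statement of a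
block touches the cells of a given trace, and inputs are constant inside a block. Satisfaction of
the formula extends these `m` executions to `n` executions of `P` that together satisfy the body `ψ`
(`exists_hyper_of_sat_foldr`). Label every time `t` with the set `l t` of the atoms of `ψ` that are
true then. The word `l` is accepted by the automaton for `ψ`, so that the word
`w t = combine((s₁)_{π₁}; …; (sₙ)_{πₙ}, l t)` is accepted by the combined product.

The main point is that `w` can be executed (`runs_combine`, `executable_combine`): the saved
values, the cells and the inputs are those of the `n` executions, and the two assertions hold
because `l t` describes the actual truth values. Consequently neither removal step rejects `w`.
Every finite factor of `w` is feasible, which keeps it when `k`-infeasibility is removed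
(`Executable.mem_removeInfeasible`), and every suffix of `w` is feasible, whereas the words rejected
with the infeasible accepting cycles have an infeasible suffix (`Executable.mem_cyclesRemoved`).
Projecting an accepting run on `w` to the first `m` copies gives an accepting run on `σ`.

Executions are handled block by block: `Runs s a b` says that the composed statement `s` leads from
`a` to `b`, and `feasible_of_runs` glues blocks to a computation that matches the flattened trace.
-/

/-! ### Block-wise execution of statements -/

section Execution

variable {T : Theory.{u}} {I C : Type u}

/-- Executing the basic statements of a list one after the other may lead from the assignment `a`
to the assignment `b`. Inputs are unconstrained here. -/
def Runs : Stmt T I C → Assignment T (I ⊕ C) → Assignment T (I ⊕ C) → Prop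
  | [], a, b => a = b
  | s :: l, a, c => ∃ b, s.Step a b ∧ Runs l b c

theorem Runs.append {l l' : Stmt T I C} {a b c : Assignment T (I ⊕ C)} (h : Runs l a b)
    (h' : Runs l' b c) : Runs (l ++ l') a c := by
  induction l generalizing a with
  | nil => cases h; exact h'
  | cons s l ih =>
    obtain ⟨d, hd, hl⟩ := h
    exact ⟨d, hd, ih hl⟩

theorem Runs.singleton {s : BasicStmt T I C} {a b : Assignment T (I ⊕ C)} (h : s.Step a b) :
    Runs [s] a b := ⟨b, h, rfl⟩

theorem Runs.of_steps (l : Stmt T I C) (f : ℕ → Assignment T (I ⊕ C))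
    (h : ∀ (j : ℕ) (hj : j < l.length), (l[j]).Step (f j) (f (j + 1))) :
    Runs l (f 0) (f l.length) := by
  induction l generalizing f with
  | nil => rfl
  | cons s l ih =>
    refine ⟨f 1, h 0 (by simp), ih (fun j => f (j + 1)) fun j hj => ?_⟩
    exact h (j + 1) (by simpa using hj)

theorem Runs.exists_steps {l : Stmt T I C} {a b : Assignment T (I ⊕ C)} (h : Runs l a b) :
    ∃ f : ℕ → Assignment T (I ⊕ C), f 0 = a ∧ f l.length = b ∧
      ∀ (j : ℕ) (hj : j < l.length), (l[j]).Step (f j) (f (j + 1)) := by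
  induction l generalizing a with
  | nil => cases h; exact ⟨fun _ => b, rfl, rfl, fun j hj => by simp at hj⟩
  | cons s l ih =>
    obtain ⟨d, hd, hl⟩ := h
    obtain ⟨f, h0, h1, hf⟩ := ih hl
    refine ⟨fun j => Nat.casesOn j a f, rfl, h1, fun j hj => ?_⟩
    cases j with
    | zero => simpa [h0] using hd
    | succ j => exact hf j (by simpa using hj)

theorem blockStart_succ (σ : ℕ → Stmt T I C) (t : ℕ) :
    blockStart σ (t + 1) = blockStart σ t + (σ t).length := by
  simp [blockStart, Finset.sum_range_succ]

theorem blockStart_mono (σ : ℕ → Stmt T I C) : Monotone (blockStart σ) :=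
  monotone_nat_of_le_succ fun t => by rw [blockStart_succ]; omega

/-- A position inside block `t` lies before the start of every later block. -/
theorem block_index_le (σ : ℕ → Stmt T I C) {t t' j j' : ℕ} (hj : j < (σ t).length)
    (e : blockStart σ t + j = blockStart σ t' + j') : t' ≤ t := by
  by_contra hlt
  have := blockStart_mono σ (show t + 1 ≤ t' by omega)
  rw [blockStart_succ] at this
  omega

/-- Executions of the single blocks, glued at the block boundaries, form a computation. Without
inputs, no further condition has to be met inside a block. -/
theorem feasible_of_runs [IsEmpty I] {σ : ℕ → Stmt T I C} (a : ℕ → Assignment T (I ⊕ C))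
    (hne : ∀ t, σ t ≠ []) (h : ∀ t, Runs (σ t) (a t) (a (t + 1))) : Feasible (a 0) σ := by
  classical
  choose f h0 h1 hf using fun t => (h t).exists_steps
  -- `G p` is the assignment before the basic statement at position `p`.
  obtain ⟨G, hG⟩ : ∃ G : ℕ → Assignment T (I ⊕ C),
      ∀ t j, j < (σ t).length → G (blockStart σ t + j) = f t j := by
    refine ⟨fun p => if hp : ∃ x : ℕ × ℕ, x.2 < (σ x.1).length ∧ p = blockStart σ x.1 + x.2
      then f hp.choose.1 hp.choose.2 else a 0, fun t j hj => ?_⟩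
    have hp : ∃ x : ℕ × ℕ, x.2 < (σ x.1).length ∧ blockStart σ t + j = blockStart σ x.1 + x.2 :=
      ⟨(t, j), hj, rfl⟩
    obtain ⟨hl, he⟩ := hp.choose_spec
    have e1 : hp.choose.1 = t :=
      le_antisymm (block_index_le σ hj he) (block_index_le σ hl he.symm)
    rw [e1] at he
    have e2 : hp.choose.2 = j := by omega
    simp only [dif_pos hp]
    rw [e1, e2]
  have hpos : ∀ t, 0 < (σ t).length := fun t => List.length_pos_iff.2 (hne t)
  have hG' : ∀ t j, j ≤ (σ t).length → G (blockStart σ t + j) = f t j := by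
    intro t j hj
    rcases hj.lt_or_eq with hj | rfl
    · exact hG t j hj
    · rw [← blockStart_succ, h1, ← h0, ← hG _ _ (hpos _)]; rfl
  have hG0 : G 0 = a 0 := by
    have := hG 0 0 (hpos 0)
    rwa [h0, show blockStart σ 0 = 0 from rfl] at this
  have hprev : ∀ p, prev (a 0) (fun q => G (q + 1)) p = G p := by
    intro p
    cases p with
    | zero => exact hG0.symm
    | succ p => rfl
  refine ⟨fun p => G (p + 1), fun t j hj => ⟨?_, fun _ i => isEmptyElim i⟩⟩
  rw [hprev, hG t j hj]
  dsimp only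
  rw [add_assoc, hG' t (j + 1) hj]
  exact hf t j hj

/-- A step only constrains the cells of its target assignment. -/
theorem BasicStmt.Step.congr_right {s : BasicStmt T I C} {a b b' : Assignment T (I ⊕ C)}
    (h : s.Step a b) (hb : ∀ c, b' (.inr c) = b (.inr c)) : s.Step a b' := by
  cases s <;> simp only [BasicStmt.Step, hb] at h ⊢ <;> exact h

end Execution

/-! ### Indexed statements -/

section Indexed

variable {T : Theory.{u}} {I C : Type u} {n : ℕ}

/-- The assignment that a hyper-assignment gives to the trace `π`. -/
def component (π : Fin n) (a : Assignment T ((I × Fin n) ⊕ (C × Fin n))) :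
    Assignment T (I ⊕ C) :=
  fun x => a (Sum.map (fun i => (i, π)) (fun c => (c, π)) x)

/-- A statement indexed by `π` acts on the trace `π` like the original statement, and leaves the
cells of the other traces alone. -/
theorem step_index_iff {π : Fin n} {s : BasicStmt T I C}
    {a b : Assignment T ((I × Fin n) ⊕ (C × Fin n))} :
    (s.index π).Step a b ↔ s.Step (component π a) (component π b) ∧
      ∀ c π', π' ≠ π → b (.inr (c, π')) = a (.inr (c, π')) := by
  cases s with
  | assert p =>
    simp only [BasicStmt.index, BasicStmt.map, BasicStmt.Step, PredTerm.map, Term.eval_map]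
    constructor
    · exact fun ⟨h, hc⟩ => ⟨⟨h, fun c => hc _⟩, fun c π' _ => hc _⟩
    · rintro ⟨⟨h, hc⟩, h'⟩
      refine ⟨h, fun ⟨c, π'⟩ => ?_⟩
      by_cases e : π' = π
      · subst e; exact hc c
      · exact h' c π' e
  | assign c τ =>
    simp only [BasicStmt.index, BasicStmt.map, BasicStmt.Step, Term.eval_map]
    constructor
    · exact fun ⟨h, hc⟩ => ⟨⟨h, fun c' hc' => hc _ fun e => hc' (congrArg Prod.fst e)⟩,
        fun c' π' hπ => hc _ fun e => hπ (congrArg Prod.snd e)⟩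
    · rintro ⟨⟨h, hc⟩, h'⟩
      refine ⟨h, fun ⟨c', π'⟩ hne => ?_⟩
      by_cases e : π' = π
      · subst e; exact hc c' fun e => hne (by rw [e])
      · exact h' c' π' e
  | havoc c =>
    simp only [BasicStmt.index, BasicStmt.map, BasicStmt.Step]
    constructor
    · exact fun hc => ⟨fun c' hc' => hc _ fun e => hc' (congrArg Prod.fst e),
        fun c' π' hπ => hc _ fun e => hπ (congrArg Prod.snd e)⟩
    · rintro ⟨hc, h'⟩ ⟨c', π'⟩ hne
      by_cases e : π' = π
      · subst e; exact hc c' fun e => hne (by rw [e])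
      · exact h' c' π' e

/-- In a block `(s₁)_{π₁}; …; (sₙ)_{πₙ}` only the `i`-th statement touches the cells of the `i`-th
trace, and the inputs are constant before the block ends. So each trace makes one step. -/
theorem component_step_of_block {s : Fin n → BasicStmt T I C}
    {f : ℕ → Assignment T ((I × Fin n) ⊕ (C × Fin n))}
    (hs : ∀ i : Fin n, ((s i).index i).Step (f i) (f (i + 1)))
    (hin : ∀ j, j + 1 < n → ∀ x, f (j + 1) (.inl x) = f j (.inl x)) (i : Fin n) :
    (s i).Step (component i (f 0)) (component i (f n)) := by
  have hinputs : ∀ j, j < n → ∀ x, f j (.inl x) = f 0 (.inl x) := by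
    intro j
    induction j with
    | zero => intros; rfl
    | succ j ih => intro hj x; rw [hin j hj, ih (by omega)]
  have hbefore : ∀ j, j ≤ i.val → ∀ c, f j (.inr (c, i)) = f 0 (.inr (c, i)) := by
    intro j
    induction j with
    | zero => intros; rfl
    | succ j ih =>
      intro hj c
      rw [← ih (by omega) c]
      refine (step_index_iff.1 (hs ⟨j, by omega⟩)).2 c i fun e => ?_
      have := congrArg Fin.val e
      simp at this
      omega
  have hafter : ∀ d, i.val + 1 + d ≤ n →
      ∀ c, f (i + 1 + d) (.inr (c, i)) = f (i + 1) (.inr (c, i)) := by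
    intro d
    induction d with
    | zero => intros; rfl
    | succ d ih =>
      intro hd c
      rw [← ih (by omega) c]
      refine (step_index_iff.1 (hs ⟨i + 1 + d, by omega⟩)).2 c i fun e => ?_
      have := congrArg Fin.val e
      simp at this
      omega
  have hsource : component i (f i) = component i (f 0) := by
    funext x
    cases x with
    | inl x => exact hinputs i i.2 _
    | inr c => exact hbefore i le_rfl c
  have hstep := (step_index_iff.1 (hs i)).1
  rw [hsource] at hstep
  refine hstep.congr_right fun c => ?_
  have := hafter (n - (i + 1)) (by omega) c
  rwa [show i.val + 1 + (n - (i + 1)) = n by omega] at this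

/-- A feasible trace of the self-composition consists of a computation for every trace, obtained by
sampling at the ends of the blocks. -/
theorem exists_matchesBasic_of_feasible {init : Assignment T (I ⊕ C)}
    {s : ℕ → Fin n → BasicStmt T I C}
    (h : Feasible (hyperInit n init) fun t => List.ofFn fun i => (s t i).index i) :
    ∃ ζ : Fin n → ℕ → Assignment T (I ⊕ C), ∀ i, MatchesBasic init (ζ i) fun t => s t i := by
  obtain ⟨ξ, hξ⟩ := h
  have hstart : ∀ t, blockStart (fun t => List.ofFn fun i => (s t i).index i) t = t * n := by
    intro t; simp [blockStart]
  have hprev : ∀ p, prev (hyperInit n init) ξ (p + 1) = ξ p := fun p => rfl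
  refine ⟨fun i t => component i (prev (hyperInit n init) ξ ((t + 1) * n)), fun i t => ?_⟩
  have hsource : prev init (fun t => component i (prev (hyperInit n init) ξ ((t + 1) * n))) t
      = component i (prev (hyperInit n init) ξ (t * n)) := by
    cases t with
    | zero =>
      rw [zero_mul]
      funext x
      cases x <;> rfl
    | succ t => rfl
  rw [hsource]
  have key := component_step_of_block (s := s t)
    (f := fun j => prev (hyperInit n init) ξ (t * n + j)) ?_ ?_ i
  · simpa only [add_mul, one_mul, add_zero] using key
  · intro i
    have := (hξ t i (by simp)).1
    rw [hstart] at this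
    simpa [← add_assoc, hprev] using this
  · intro j hj x
    have := (hξ t j (by simp; omega)).2 (by simpa using hj) x
    rwa [hstart] at this

end Indexed

/-! ### The quantifier prefix -/

section Prefix

variable {T : Theory.{u}} {I C : Type u} {n : ℕ}

theorem component_extend (h : ℕ → Assignment T ((I × Fin n) ⊕ (C × Fin n))) (π π' : Fin n)
    (ζ : ℕ → Assignment T (I ⊕ C)) (t : ℕ) :
    component π' (extend h π ζ t) = if π' = π then ζ t else component π' (h t) := by
  funext x
  cases x <;> by_cases e : π' = π <;> simp [component, extend, e]

/-- Instantiating the universal quantifiers of a prefix by the computations `E π`, and the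
existential ones by witnesses, yields a hyper-computation for the body. -/
theorem exists_hyper_of_sat_foldr {init : Assignment T (I ⊕ C)}
    {Z : Set (ℕ → Assignment T (I ⊕ C))} {ψ : TSL T (I × Fin n) (C × Fin n)} {m : ℕ}
    {E : Fin n → ℕ → Assignment T (I ⊕ C)} (hE : ∀ π : Fin n, π.val < m → E π ∈ Z)
    {L : List (Fin n)} (hL : L.Nodup) {h : ℕ → Assignment T ((I × Fin n) ⊕ (C × Fin n))}
    (hs : HyperTSL.Sat init Z h
      (L.foldr (fun π φ => if π.val < m then .all π φ else .ex π φ) (.body ψ))) :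
    ∃ h' : ℕ → Assignment T ((I × Fin n) ⊕ (C × Fin n)),
      TSL.Sat (hyperInit n init) h' 0 ψ ∧
      (∀ π ∈ L, (fun t => component π (h' t)) ∈ Z) ∧
      (∀ π ∈ L, π.val < m → (fun t => component π (h' t)) = E π) ∧
      ∀ π ∉ L, ∀ t, component π (h' t) = component π (h t) := by
  induction L generalizing h with
  | nil => exact ⟨h, hs, by simp, by simp, fun _ _ _ => rfl⟩
  | cons π L ih =>
    obtain ⟨hπ, hL⟩ := List.nodup_cons.1 hL
    obtain ⟨ζ, hζZ, hζE, hζ⟩ : ∃ ζ ∈ Z, (π.val < m → ζ = E π) ∧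
        HyperTSL.Sat init Z (extend h π ζ)
          (L.foldr (fun π φ => if π.val < m then .all π φ else .ex π φ) (.body ψ)) := by
      rw [List.foldr_cons] at hs
      by_cases e : π.val < m
      · rw [if_pos e] at hs
        exact ⟨E π, hE π e, fun _ => rfl, hs _ (hE π e)⟩
      · rw [if_neg e] at hs
        obtain ⟨ζ, hζ, h'⟩ := hs
        exact ⟨ζ, hζ, fun e' => absurd e' e, h'⟩
    obtain ⟨h', hsat, hZ, hE', hrest⟩ := ih hL hζ
    have hhead : (fun t => component π (h' t)) = ζ := by
      funext t; rw [hrest π hπ, component_extend, if_pos rfl]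
    refine ⟨h', hsat, ?_, ?_, ?_⟩
    · rintro π' hπ'
      rcases List.mem_cons.1 hπ' with rfl | hπ'
      · rwa [hhead]
      · exact hZ π' hπ'
    · rintro π' hπ' hm
      rcases List.mem_cons.1 hπ' with rfl | hπ'
      · rw [hhead]; exact hζE hm
      · exact hE' π' hπ' hm
    · intro π' hπ' t
      obtain ⟨hne, hnot⟩ := not_or.1 (fun e => hπ' (List.mem_cons.2 e))
      rw [hrest π' hnot, component_extend, if_neg hne]

end Prefix

/-! ### Predicate terms and temporal formulas -/

section Eval

variable {T : Theory.{u}} {X : Type u}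

theorem PredTerm.eval_eq {σ τ : Term T X} {a : Assignment T X} :
    (PredTerm.eq σ τ).1.eval a = T.tt ↔ σ.eval a = τ.eval a := by
  have h : (fun i => ((![σ, τ] : Fin 2 → Term T X) i).eval a) = ![σ.eval a, τ.eval a] := by
    funext i; fin_cases i <;> rfl
  simp only [PredTerm.eq, Term.eval, h]
  constructor
  · intro e
    by_contra hne
    exact T.tt_ne_ff (e.symm.trans (T.interp_eq_ne _ _ hne))
  · intro e; rw [e]; exact T.interp_eq_self _

theorem PredTerm.eval_not {p : PredTerm T X} {a : Assignment T X} :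
    p.not.1.eval a = T.tt ↔ ¬ p.1.eval a = T.tt := by
  have h : (fun i => ((![p.1] : Fin 1 → Term T X) i).eval a) = ![p.1.eval a] := by
    funext i; fin_cases i; rfl
  simp only [PredTerm.not, Term.eval, h]
  rcases p.2 a with e | e <;> rw [e]
  · simp [T.interp_not_tt, T.tt_ne_ff.symm]
  · simp [T.interp_not_ff, T.tt_ne_ff.symm]

theorem PredTerm.eval_or {p q : PredTerm T X} {a : Assignment T X} :
    (p.or q).1.eval a = T.tt ↔ p.1.eval a = T.tt ∨ q.1.eval a = T.tt := by
  have h : (fun i => ((![p.1, q.1] : Fin 2 → Term T X) i).eval a) =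
      ![p.1.eval a, q.1.eval a] := by
    funext i; fin_cases i <;> rfl
  simp only [PredTerm.or, Term.eval, h]
  rcases p.2 a with e | e <;> rcases q.2 a with e' | e' <;> rw [e, e'] <;>
    simp [T.interp_or_tt_tt, T.interp_or_tt_ff, T.interp_or_ff_tt, T.interp_or_ff_ff,
      T.tt_ne_ff.symm]

theorem PredTerm.eval_conj {top : PredTerm T X} {l : List (PredTerm T X)} {a : Assignment T X} :
    (PredTerm.conj top l).1.eval a = T.tt ↔
      top.1.eval a = T.tt ∧ ∀ p ∈ l, p.1.eval a = T.tt := by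
  induction l with
  | nil => simp [PredTerm.conj]
  | cons p l ih =>
    have e : PredTerm.conj top (p :: l) = p.and (PredTerm.conj top l) := rfl
    rw [e, PredTerm.and, PredTerm.eval_not, PredTerm.eval_or, PredTerm.eval_not,
      PredTerm.eval_not, ih, List.forall_mem_cons]
    tauto

theorem LTL.sat_congr {AP : Type u} {v w : ℕ → AP → Prop} (φ : LTL AP)
    (h : ∀ t, ∀ a ∈ φ.atoms, (v t a ↔ w t a)) (t : ℕ) : LTL.Sat v t φ ↔ LTL.Sat w t φ := by
  induction φ generalizing t with
  | atom a => exact h t a (by simp [LTL.atoms])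
  | not φ ih => exact not_congr (ih h t)
  | and φ ψ ih ih' =>
    exact and_congr (ih (fun t a ha => h t a (List.mem_append_left _ ha)) t)
      (ih' (fun t a ha => h t a (List.mem_append_right _ ha)) t)
  | next φ ih => exact ih h (t + 1)
  | untl φ ψ ih ih' =>
    simp only [LTL.Sat, ih fun t a ha => h t a (List.mem_append_left _ ha),
      ih' fun t a ha => h t a (List.mem_append_right _ ha)]

/-- The set of atoms of `ψ` that hold at time `t`. -/
def trueAtoms {I C : Type u} (ψ : TSL T I C) (init : Assignment T (I ⊕ C))
    (ζ : ℕ → Assignment T (I ⊕ C)) (t : ℕ) : Label ψ :=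
  ⟨{a | a ∈ ψ.atoms ∧ Atom.Holds init ζ t a}, fun _ ha => ha.1⟩

theorem trueAtoms_mem_language {I C : Type u} {ψ : TSL T I C} {A : Buchi.{u} (Label ψ)}
    (hA : IsAutomatonFor A) {init : Assignment T (I ⊕ C)} {ζ : ℕ → Assignment T (I ⊕ C)}
    (h : TSL.Sat init ζ 0 ψ) : trueAtoms ψ init ζ ∈ A.language := by
  rw [hA]
  refine (LTL.sat_congr ψ (fun t a ha => ?_) 0).1 h
  simp [trueAtoms, ha]

end Eval

/-! ### Executing combined statements -/

section Combine

variable {T : Theory.{u}} {I C : Type u}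

/-- The assignment to the cells `ℂ*` that agrees with `u` on inputs and cells and gives `tmpⱼ` the
value `g j`. -/
def starAssignment (u : Assignment T (I ⊕ C)) (g : ℕ → T.V) :
    Assignment T (PEmpty.{u + 1} ⊕ StarCell I C)
  | .inl x => x.elim
  | .inr (.cell c) => u (.inr c)
  | .inr (.input i) => u (.inl i)
  | .inr (.tmp j) => g j

theorem eval_map_toStar (u : Assignment T (I ⊕ C)) (g : ℕ → T.V) (τ : Term T (I ⊕ C)) :
    (τ.map toStar).eval (starAssignment u g) = τ.eval u := by
  rw [Term.eval_map]
  congr 1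
  funext x
  cases x <;> rfl

/-- Saving the values of the terms of a list into consecutive cells `tmpₖ, tmpₖ₊₁, …`. -/
theorem runs_saveList (u : Assignment T (I ⊕ C)) (L : List (C × Term T (I ⊕ C))) (k : ℕ)
    (g g' : ℕ → T.V) (hout : ∀ j, j < k ∨ k + L.length ≤ j → g' j = g j)
    (hin : ∀ (j : ℕ) (hj : j < L.length), g' (k + j) = (L[j]).2.eval u) :
    Runs ((L.zipIdx k).map fun x =>
        BasicStmt.assign (I := PEmpty.{u + 1}) (StarCell.tmp (I := I) (C := C) x.2)
          (x.1.2.map toStar)) (starAssignment u g) (starAssignment u g') := by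
  induction L generalizing k g with
  | nil =>
    have : g' = g := funext fun j => hout j (by simp; omega)
    rw [this]; rfl
  | cons x L ih =>
    refine ⟨starAssignment u (Function.update g k (x.2.eval u)), ⟨?_, ?_⟩, ih (k + 1) _ ?_ ?_⟩
    · simp [eval_map_toStar, starAssignment]
    · intro c hc
      cases c with
      | tmp j =>
        have hj : j ≠ k := fun e => hc (by rw [e])
        simp [starAssignment, hj]
      | _ => rfl
    · intro j hj
      rcases eq_or_ne j k with rfl | hjk
      · rw [Function.update_self]
        exact hin 0 (by simp)
      · rw [Function.update_of_ne hjk]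
        refine hout j ?_
        simp only [List.length_cons]
        omega
    · intro j hj
      have := hin (j + 1) (by simpa using hj)
      simpa [add_assoc, add_comm, add_left_comm] using this

theorem step_map_toStar {s : BasicStmt T I C} {u v : Assignment T (I ⊕ C)} (h : s.Step u v)
    (hin : ∀ i, v (.inl i) = u (.inl i)) (g : ℕ → T.V) :
    (s.map toStar StarCell.cell).Step (starAssignment u g) (starAssignment v g) := by
  cases s with
  | assert p =>
    refine ⟨?_, fun c => ?_⟩
    · simpa [PredTerm.map, eval_map_toStar] using h.1
    · cases c with
      | cell c => exact h.2 c
      | input i => exact hin i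
      | tmp j => rfl
  | assign c τ =>
    refine ⟨?_, fun c' hc' => ?_⟩
    · simpa [eval_map_toStar, starAssignment] using h.1
    · cases c' with
      | cell c' => exact h.2 c' fun e => hc' (by rw [e])
      | input i => exact hin i
      | tmp j => rfl
  | havoc c =>
    intro c' hc'
    cases c' with
    | cell c' => exact h c' fun e => hc' (by rw [e])
    | input i => exact hin i
    | tmp j => rfl

/-- The indexed statements of one step of all traces update the cells, trace by trace, while the
inputs keep their old values. -/
theorem runs_indexed {n : ℕ} {s : Fin n → BasicStmt T I C}
    {u v : Assignment T ((I × Fin n) ⊕ (C × Fin n))}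
    (h : ∀ i, (s i).Step (component i u) (component i v)) (g : ℕ → T.V) :
    Runs ((List.ofFn fun i => (s i).index i).map fun b => b.map toStar StarCell.cell)
      (starAssignment u g) (starAssignment (Sum.elim (fun x => u (.inl x)) fun x => v (.inr x)) g)
      := by
  -- After `j` statements exactly the traces below `j` have made their step.
  let f : ℕ → Assignment T ((I × Fin n) ⊕ (C × Fin n)) := fun j =>
    Sum.elim (fun x => u (.inl x)) fun x => if x.2.val < j then v (.inr x) else u (.inr x)
  have h0 : u = f 0 := by
    funext x; cases x <;> simp [f]
  have h1 : (Sum.elim (fun x => u (.inl x)) fun x => v (.inr x)) = f n := by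
    funext x; cases x <;> simp [f]
  have := Runs.of_steps
    ((List.ofFn fun i => (s i).index i).map fun b => b.map toStar StarCell.cell)
    (fun j => starAssignment (f j) g) ?_
  · rw [h1]
    nth_rewrite 1 [h0]
    simpa using this
  · intro j hj
    have hj' : j < n := by simpa using hj
    simp only [List.getElem_map, List.getElem_ofFn]
    refine step_map_toStar (u := f j) (v := f (j + 1)) (step_index_iff.2 ⟨?_, ?_⟩) (fun _ => rfl) g
    · have e : component (⟨j, hj'⟩ : Fin n) (f j) = component ⟨j, hj'⟩ u := by
        funext x; cases x <;> simp [component, f]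
      rw [e]
      refine (h ⟨j, hj'⟩).congr_right fun c => ?_
      simp [component, f]
    · intro c π hπ
      have hne : π.val ≠ j := fun e => hπ (Fin.ext e)
      have : π.val < j + 1 ↔ π.val < j := by omega
      simp [f, this]

theorem runs_havocInputs (L : List I) (u v : Assignment T (I ⊕ C))
    (hcell : ∀ c, v (.inr c) = u (.inr c)) (hin : ∀ i, i ∉ L → v (.inl i) = u (.inl i))
    (g : ℕ → T.V) :
    Runs (L.map fun i => BasicStmt.havoc (I := PEmpty.{u + 1}) (StarCell.input (C := C) i))
      (starAssignment u g) (starAssignment v g) := by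
  classical
  induction L generalizing u with
  | nil =>
    have : u = v := by
      funext x
      cases x with
      | inl i => exact (hin i (by simp)).symm
      | inr c => exact (hcell c).symm
    rw [this]; rfl
  | cons i L ih =>
    refine ⟨starAssignment (Function.update u (.inl i) (v (.inl i))) g, ?_, ih _ ?_ ?_⟩
    · intro c hc
      cases c with
      | input j =>
        have hj : j ≠ i := fun e => hc (by rw [e])
        simp [starAssignment, hj]
      | cell c => simp [starAssignment]
      | tmp j => rfl
    · intro c; simp [hcell]
    · intro j hj
      rcases eq_or_ne j i with rfl | hji
      · simp
      · rw [Function.update_of_ne (by simpa using hji)]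
        exact hin j (by simp [hji, hj])

theorem eval_starTrue (a : Assignment T (PEmpty.{u + 1} ⊕ StarCell I C)) :
    (starTrue T I C).1.eval a = T.tt := PredTerm.eval_eq.2 rfl

theorem mem_atoms_of_mem_preds {ψ : TSL T I C} {p : PredTerm T (I ⊕ C)} (h : p ∈ preds ψ) :
    .inl p ∈ ψ.atoms := by
  classical
  simpa [preds, List.mem_filterMap] using h

theorem mem_atoms_of_mem_updates {ψ : TSL T I C} {x : C × Term T (I ⊕ C)}
    (h : x ∈ updates ψ) : .inr x ∈ ψ.atoms := by
  classical
  simpa [updates, List.mem_filterMap] using h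

theorem eval_checkPreds {ψ : TSL T I C} {l : Label ψ} {v : Assignment T (I ⊕ C)} {g : ℕ → T.V}
    (h : ∀ p, .inl p ∈ ψ.atoms → (.inl p ∈ l.1 ↔ p.1.eval v = T.tt)) :
    (checkPreds l).1.eval (starAssignment v g) = T.tt := by
  classical
  refine PredTerm.eval_conj.2 ⟨eval_starTrue _, fun p hp => ?_⟩
  rcases List.mem_append.1 hp with hp | hp <;> obtain ⟨q, hq, rfl⟩ := List.mem_map.1 hp
  · obtain ⟨hq, hl⟩ := List.mem_filter.1 hq
    have := (h q (mem_atoms_of_mem_preds hq)).1 (by simpa using hl)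
    simpa [PredTerm.map, eval_map_toStar] using this
  · obtain ⟨hq, hl⟩ := List.mem_filter.1 hq
    have := mt (h q (mem_atoms_of_mem_preds hq)).2 (by simpa using hl)
    rw [PredTerm.eval_not]
    simpa [PredTerm.map, eval_map_toStar] using this

theorem eval_checkUpdates {ψ : TSL T I C} {l : Label ψ} {u v : Assignment T (I ⊕ C)}
    {g : ℕ → T.V}
    (hg : ∀ (j : ℕ) (hj : j < (updates ψ).length), g j = ((updates ψ)[j]).2.eval u)
    (h : ∀ c τ, .inr (c, τ) ∈ ψ.atoms → (.inr (c, τ) ∈ l.1 ↔ τ.eval u = v (.inr c))) :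
    (checkUpdates l).1.eval (starAssignment v g) = T.tt := by
  classical
  refine PredTerm.eval_conj.2 ⟨eval_starTrue _, fun p hp => ?_⟩
  obtain ⟨⟨⟨c, τ⟩, j⟩, hx, rfl⟩ := List.mem_map.1 hp
  obtain ⟨hj, hget⟩ : ∃ hj : j < (updates ψ).length, (updates ψ)[j] = (c, τ) := by
    rw [List.mem_zipIdx_iff_getElem?] at hx
    exact List.getElem?_eq_some_iff.1 hx
  have hmem : (c, τ) ∈ updates ψ := hget ▸ List.getElem_mem hj
  have hval := hg j hj
  rw [hget] at hval
  have hiff := h c τ (mem_atoms_of_mem_updates hmem)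
  have heq : (PredTerm.eq (starVar T (.cell c : StarCell I C)) (starVar T (.tmp j))).1.eval
      (starAssignment v g) = T.tt ↔ .inr (c, τ) ∈ l.1 := by
    rw [PredTerm.eval_eq, hiff]
    change v (.inr c) = g j ↔ _
    rw [hval]
    exact eq_comm
  by_cases hl : (.inr (c, τ) : Atom T I C) ∈ l.1
  · simp only [if_pos hl]
    exact heq.2 hl
  · simp only [if_neg hl]
    exact PredTerm.eval_not.2 (mt heq.1 hl)

/-- The values of the cells `tmpⱼ` after the terms of the updates of `ψ` were saved in the assignment
`u`; the cells that no statement writes hold `tt`. -/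
noncomputable def savedValues (ψ : TSL T I C) (u : Assignment T (I ⊕ C)) (j : ℕ) : T.V :=
  ((updates ψ)[j]?).elim T.tt fun x => x.2.eval u

/-- The statement `combine(s, l)` leads from `u` to `v` if `s` does so, trace by trace, and `l` is
the set of atoms of `ψ` that are true in `v` after `u`. -/
theorem runs_combine [Fintype I] {n : ℕ} {ψ : TSL T (I × Fin n) (C × Fin n)}
    {s : Fin n → BasicStmt T I C} {l : Label ψ}
    {u v : Assignment T ((I × Fin n) ⊕ (C × Fin n))}
    (h : ∀ i, (s i).Step (component i u) (component i v))
    (hp : ∀ p, .inl p ∈ ψ.atoms → (.inl p ∈ l.1 ↔ p.1.eval v = T.tt))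
    (hu : ∀ c τ, .inr (c, τ) ∈ ψ.atoms → (.inr (c, τ) ∈ l.1 ↔ τ.eval u = v (.inr c)))
    {g : ℕ → T.V} (hg : ∀ j, (updates ψ).length ≤ j → g j = T.tt) :
    Runs (combine (List.ofFn fun i => (s i).index i) l) (starAssignment u g)
      (starAssignment v (savedValues ψ u)) := by
  have hsaved : ∀ (j : ℕ) (hj : j < (updates ψ).length),
      savedValues ψ u j = ((updates ψ)[j]).2.eval u := by
    intro j hj; simp [savedValues, hj]
  refine ((((runs_saveList u (updates ψ) 0 g (savedValues ψ u) ?_ ?_).append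
    (runs_indexed h _)).append 
      (runs_havocInputs _ (Sum.elim (fun x => u (.inl x)) fun x => v (.inr x)) v
        (fun _ => rfl) ?_ _)).append
    (.singleton (s := .assert _) ⟨eval_checkPreds hp, fun _ => rfl⟩)).append
    (.singleton (s := .assert _) ⟨eval_checkUpdates hsaved hu, fun _ => rfl⟩)
  · intro j hj
    have hj : (updates ψ).length ≤ j := by omega
    simp [hg j hj, savedValues, hj]
  · simpa using hsaved
  · intro i hi
    exact absurd (by simp) hi

theorem combine_ne_nil [Fintype I] {ψ : TSL T I C} (s : Stmt T I C) (l : Label ψ) :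
    combine s l ≠ [] := by simp [combine]

end Combine

/-! ### Removal of infeasible words -/

section Removal

variable {T : Theory.{u}} {I C : Type u}

/-- The word `w` of statements can be executed from some assignment: `a t` is the assignment before
the statement `w t`. No statement is empty, so that the blocks cover all positions of the flattened
word. -/
def Executable (w : ℕ → StarStmt T I C) : Prop :=
  (∀ t, w t ≠ []) ∧
    ∃ a : ℕ → Assignment T (PEmpty.{u + 1} ⊕ StarCell I C), ∀ t, Runs (w t) (a t) (a (t + 1))

theorem Executable.exists_feasible {w : ℕ → StarStmt T I C} (h : Executable w) :
    ∃ init, Feasible init w := by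
  obtain ⟨hne, a, ha⟩ := h
  exact ⟨a 0, feasible_of_runs a hne ha⟩

theorem Executable.suffix {w : ℕ → StarStmt T I C} (h : Executable w) (d : ℕ) :
    Executable fun t => w (d + t) := by
  obtain ⟨hne, a, ha⟩ := h
  exact ⟨fun t => hne _, fun t => a (d + t), fun t => ha (d + t)⟩

theorem Executable.feasibleSeq {w : ℕ → StarStmt T I C} (h : Executable w) (d len : ℕ) :
    FeasibleSeq ((List.range' d len).map w) := by
  obtain ⟨hne, a, ha⟩ := h
  have hget : ∀ t, ((List.range' d len).map w).getD t [.assert (starTrue T I C)] =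
      if t < len then w (d + t) else [.assert (starTrue T I C)] := by
    intro t
    by_cases ht : t < len <;> simp [List.getD, ht]
  refine ⟨_, feasible_of_runs (fun t => a (d + min t len)) (fun t => ?_) fun t => ?_⟩ <;>
    rw [hget] <;> split_ifs with ht
  · exact hne _
  · simp
  · rw [min_eq_left ht.le, min_eq_left (show t + 1 ≤ len from ht)]
    exact ha (d + t)
  · rw [min_eq_right (by omega), min_eq_right (by omega)]
    exact .singleton ⟨eval_starTrue _, fun _ => rfl⟩

/-- The `len` steps of the run `r` on the word `w` that start at time `d`. -/
def window {Q S : Type u} (r : ℕ → Q) (w : ℕ → S) (d len : ℕ) : PathSeq Q S :=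
  (r d, (List.range' d len).map fun j => (w j, r (j + 1)))

theorem window_last {Q S : Type u} (r : ℕ → Q) (w : ℕ → S) (d len : ℕ) :
    (window r w d len).last = r (d + len) := by
  cases len with
  | zero => simp [window, PathSeq.last]
  | succ len =>
    simp [window, PathSeq.last, List.range'_concat, add_assoc]

theorem window_labels {Q S : Type u} (r : ℕ → Q) (w : ℕ → S) (d len : ℕ) :
    (window r w d len).labels = (List.range' d len).map w := by
  simp [window, PathSeq.labels, Function.comp_def]

theorem window_snoc {Q S : Type u} (r : ℕ → Q) (w : ℕ → S) (d len : ℕ) :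
    (window r w d len).snoc (w (d + len)) (r (d + len + 1)) = window r w d (len + 1) := by
  simp [window, PathSeq.snoc, List.range'_concat]

theorem window_tail {Q S : Type u} (r : ℕ → Q) (w : ℕ → S) (d len : ℕ) :
    (window r w d (len + 1)).tail = window r w (d + 1) len := by
  simp [window, PathSeq.tail, List.range'_succ]

theorem isPath_window {S : Type u} {A : Buchi.{u} S} {r : ℕ → A.Q} {w : ℕ → S}
    (h : ∀ t, (r t, w t, r (t + 1)) ∈ A.trans) (d len : ℕ) :
    IsPath A (window r w d len).1 (window r w d len).2 := by
  induction len generalizing d with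
  | zero => trivial
  | succ len ih => exact ⟨h d, ih (d + 1)⟩

/-- Every factor of an executable word is feasible, so that the run which remembers the last steps
of a given run never meets a removed transition. -/
theorem Executable.mem_removeInfeasible {A : Buchi.{u} (StarStmt T I C)} {w : ℕ → StarStmt T I C}
    (hw : Executable w) (hA : w ∈ A.language) (k : ℕ) :
    w ∈ (removeInfeasible A k).language := by
  cases k with
  | zero => exact hA
  | succ K =>
    obtain ⟨r, h0, ht, hacc⟩ := hA
    -- At time `t` the steps since time `t - K` are remembered, or all steps if `t < K`.
    refine ⟨fun t => ⟨window r w (t - K) (t - (t - K)), isPath_window ht _ _, ?_⟩, ?_, ?_, ?_⟩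
    · rcases le_or_gt K t with hK | hK
      · left; simp [window]; omega
      · right; rw [show t - K = 0 by omega]; exact ⟨by simpa [window] using hK, h0⟩
    · exact Subtype.ext (by simp [window, h0]; rfl)
    · intro t
      have hlen : (window r w (t - K) (t - (t - K))).2.length = t - (t - K) := by simp [window]
      have ht' : t - K + (t - (t - K)) = t := by omega
      refine ⟨r (t + 1), ?_, ?_, ?_⟩
      · simpa [window_last, ht'] using ht t
      · have := hw.feasibleSeq (t - K) (t - (t - K) + 1)
        rw [List.range'_concat] at this
        simpa [window_labels, ht'] using this
      · have hsnoc := window_snoc r w (t - K) (t - (t - K))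
        rw [ht'] at hsnoc
        simp only [hlen, hsnoc, window_tail]
        rcases le_or_gt K t with hK | hK
        · left
          refine ⟨by omega, ?_⟩
          rw [show t + 1 - K = t - K + 1 by omega,
            show t + 1 - (t - K + 1) = t - (t - K) by omega]
        · right
          refine ⟨by omega, ?_⟩
          rw [show t + 1 - K = 0 by omega, show t - K = 0 by omega]
          rfl
    · convert hacc using 2
      ext t
      change (window r w (t - K) (t - (t - K))).last ∈ A.acc ↔ r t ∈ A.acc
      rw [window_last, show t - K + (t - (t - K)) = t by omega]

/-- Words accepted by the automaton of a cycle end with the word of the cycle. -/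
theorem exists_suffix_of_mem_cycleAutomaton {Q S : Type u} {c : CycleSeq Q S} {w : ℕ → S}
    (h : w ∈ (cycleAutomaton c).language) : ∃ d, (fun t => w (d + t)) = c.word := by
  obtain ⟨r, h0, ht, hacc⟩ : ∃ r : ℕ → Option (Fin (c.len + 1)), r 0 = none ∧
      (∀ t, (r t = none ∧ r (t + 1) = none) ∨
        (∃ j, (r t, w t, r (t + 1)) = (some j, c.label j, some (j + 1))) ∨
        (r t, w t, r (t + 1)) = (none, c.label 0, some (0 + 1))) ∧
      {t | r t ≠ none}.Infinite := h
  -- The run leaves the initial state at time `d`.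
  have hex : ∃ t, r t ≠ none := hacc.nonempty
  obtain ⟨d, hd, hd'⟩ : ∃ d, r d = none ∧ r (d + 1) ≠ none := by
    classical
    have hfind := Nat.find_spec hex
    have hpos : Nat.find hex ≠ 0 := fun e => hfind (by rw [e]; exact h0)
    obtain ⟨d, hd⟩ := Nat.exists_eq_succ_of_ne_zero hpos
    rw [hd] at hfind
    refine ⟨d, ?_, hfind⟩
    by_contra hne
    have := Nat.find_min' hex hne
    omega
  have hstep : ∀ j t, r t = some j → w t = c.label j ∧ r (t + 1) = some (j + 1) := by
    intro j t hj
    rcases ht t with h | ⟨j', h⟩ | h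
    · simp [hj] at h
    · simp only [Prod.mk.injEq, hj, Option.some.injEq] at h
      obtain ⟨rfl, h1, h2⟩ := h
      exact ⟨h1, h2⟩
    · simp [hj] at h
  have hfirst : w d = c.label 0 ∧ r (d + 1) = some (0 + 1) := by
    rcases ht d with h | ⟨j', h⟩ | h
    · exact absurd h.2 hd'
    · simp [hd] at h
    · simp only [Prod.mk.injEq] at h
      exact h.2
  have hsucc : ∀ t : ℕ, (Fin.ofNat (c.len + 1) (t + 1)) = Fin.ofNat (c.len + 1) t + 1 := by
    intro t
    ext
    simp [Fin.ofNat, Fin.val_add]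
  have hstate : ∀ t, r (d + 1 + t) = some (Fin.ofNat (c.len + 1) (t + 1)) := by
    intro t
    induction t with
    | zero => rw [hsucc]; exact hfirst.2
    | succ t ih => rw [hsucc]; exact (hstep _ _ ih).2
  refine ⟨d, funext fun t => ?_⟩
  cases t with
  | zero => exact hfirst.1
  | succ t =>
    have := (hstep _ _ (hstate t)).1
    rwa [add_assoc, add_comm 1 t] at this

theorem Executable.mem_cyclesRemoved {w : ℕ → StarStmt T I C} (hw : Executable w) {r : ℕ}
    {A B : Buchi.{u} (StarStmt T I C)} (h : CyclesRemoved r A B) (hA : w ∈ A.language) :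
    w ∈ B.language := by
  induction h with
  | zero A => exact hA
  | succ r A B D S h hS hD ih =>
    rw [hD]
    refine ⟨ih hA, fun hmem => ?_⟩
    obtain ⟨c, hc, hwc⟩ := Set.mem_iUnion₂.1 hmem
    obtain ⟨d, hd⟩ := exists_suffix_of_mem_cycleAutomaton hwc
    obtain ⟨init, hf⟩ := (hw.suffix d).exists_feasible
    exact (hS c hc).2.2 init (hd ▸ hf)

end Removal

/-! ### Languages of the constructed automata -/

section Languages

variable {T : Theory.{u}} {I C : Type u}

theorem exists_of_mem_selfComp {m : ℕ} {P : Buchi.{u} (BasicStmt T I C)}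
    (hP : P.acc = Set.univ) {σ : ℕ → Stmt T (I × Fin m) (C × Fin m)}
    (h : σ ∈ (selfComp m P).language) :
    ∃ s : ℕ → Fin m → BasicStmt T I C, (σ = fun t => List.ofFn fun i => (s t i).index i) ∧
      ∀ i, (fun t => s t i) ∈ P.language := by
  obtain ⟨r, h0, ht, -⟩ := h
  choose s hs hσ using ht
  refine ⟨s, funext hσ, fun i => ⟨fun t => r t i, congrFun h0 i, fun t => hs t i, ?_⟩⟩
  rw [hP]
  simpa using Set.infinite_univ

theorem mem_combinedProduct [Fintype I] {n : ℕ} {P : Buchi.{u} (BasicStmt T I C)}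
    {ψ : TSL T (I × Fin n) (C × Fin n)} {A : Buchi.{u} (Label ψ)}
    {s : ℕ → Fin n → BasicStmt T I C} (hs : ∀ i, (fun t => s t i) ∈ P.language)
    {l : ℕ → Label ψ} (hl : l ∈ A.language) :
    (fun t => combine (List.ofFn fun i => (s t i).index i) (l t)) ∈
      (combinedProduct (selfComp n P) A).language := by
  choose r h0 ht _ using hs
  obtain ⟨q, hq0, hqt, hacc⟩ := hl
  refine ⟨fun t => (fun i => r i t, q t), ?_, fun t => ?_, hacc⟩
  · exact Prod.ext (funext h0) hq0
  · exact ⟨_, l t, ⟨s t, fun i => ht i t, rfl⟩, hqt t, rfl⟩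

theorem mem_projectUniversal [Fintype I] {m n : ℕ} (hmn : m ≤ n)
    {ψ : TSL T (I × Fin n) (C × Fin n)} {B : Buchi.{u} (StarStmt T (I × Fin n) (C × Fin n))}
    {s : ℕ → Fin n → BasicStmt T I C} {l : ℕ → Label ψ}
    (h : (fun t => combine (List.ofFn fun i => (s t i).index i) (l t)) ∈ B.language) :
    (fun t => List.ofFn fun i : Fin m => (s t (Fin.castLE hmn i)).index i) ∈
      (projectUniversal hmn ψ B).language := by
  obtain ⟨r, h0, ht, hacc⟩ := h
  exact ⟨r, h0, fun t => ⟨s t, l t, ht t, rfl⟩, hacc⟩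

/-- The combined trace of executions of all traces is executable if its labels tell which atoms are
true. -/
theorem executable_combine [Fintype I] {n : ℕ} {init : Assignment T (I ⊕ C)}
    {ψ : TSL T (I × Fin n) (C × Fin n)} {s : ℕ → Fin n → BasicStmt T I C}
    {ξ : ℕ → Assignment T ((I × Fin n) ⊕ (C × Fin n))}
    (h : ∀ i, MatchesBasic init (fun t => component i (ξ t)) fun t => s t i) :
    Executable fun t => combine (List.ofFn fun i => (s t i).index i)
      (trueAtoms ψ (hyperInit n init) ξ t) := by
  have hprev : ∀ i t, component i (prev (hyperInit n init) ξ t) =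
      prev init (fun t => component i (ξ t)) t := by
    intro i t
    cases t with
    | zero => funext x; cases x <;> rfl
    | succ t => rfl
  let g : ℕ → ℕ → T.V := fun t =>
    Nat.casesOn t (fun _ => T.tt) fun t => savedValues ψ (prev (hyperInit n init) ξ t)
  refine ⟨fun t => combine_ne_nil _ _,
    fun t => starAssignment (prev (hyperInit n init) ξ t) (g t), fun t => ?_⟩
  refine runs_combine (fun i => ?_) (fun p hp => ?_) (fun c τ hτ => ?_) fun j hj => ?_
  · rw [hprev]
    exact h i t
  · simp [trueAtoms, hp, Atom.Holds, prev]
  · simp [trueAtoms, hτ, Atom.Holds, prev]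
  · cases t with
    | zero => rfl
    | succ t => simp [g, savedValues, hj]

end Languages

/-! ### Soundness of the refutation -/

theorem theorem5 {T : Theory.{u}} {I C : Type u} [Fintype I]
    (init : Assignment T (I ⊕ C))
    (P : Buchi.{u} (BasicStmt T I C)) (hP : P.acc = Set.univ)
    (m n : ℕ) (hmn : m ≤ n)
    (ψ : TSL T (I × Fin n) (C × Fin n))
    (A : Buchi.{u} (Label ψ)) (hA : IsAutomatonFor A)
    (k k' : ℕ) (B : Buchi.{u} (StarStmt T (I × Fin n) (C × Fin n)))
    (hB : CyclesRemoved k' (removeInfeasible (combinedProduct (selfComp n P) A) k) B)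
    (h : ∃ σ ∈ (selfComp m P).language \ (projectUniversal hmn ψ B).language,
      Feasible (hyperInit m init) σ) :
    ¬ Satisfies init P (forallExists m n ψ) := by
  intro hsat
  obtain ⟨σ, ⟨hσ, hnot⟩, hfeas⟩ := h
  obtain ⟨s, rfl, hs⟩ := exists_of_mem_selfComp hP hσ
  obtain ⟨ζ, hζ⟩ := exists_matchesBasic_of_feasible hfeas
  -- The values of `E` on the existentially quantified traces are irrelevant.
  let E : Fin n → ℕ → Assignment T (I ⊕ C) := fun π =>
    if hπ : π.val < m then ζ ⟨π, hπ⟩ else fun _ => init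
  have hE : ∀ π : Fin n, π.val < m → E π ∈ executions init P := by
    intro π hπ
    simp only [E, dif_pos hπ]
    exact ⟨_, hs _, hζ _⟩
  obtain ⟨ξ, hψ, hZ, hξE, -⟩ := exists_hyper_of_sat_foldr hE (List.nodup_finRange n) hsat
  -- On the universally quantified traces the words are prescribed by `σ`.
  have hwords : ∀ π : Fin n, ∃ x ∈ P.language,
      MatchesBasic init (fun t => component π (ξ t)) x ∧
      ∀ hπ : π.val < m, x = fun t => s t ⟨π, hπ⟩ := by
    intro π
    by_cases hπ : π.val < m
    · refine ⟨_, hs ⟨π, hπ⟩, ?_, fun _ => rfl⟩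
      rw [hξE π (List.mem_finRange π) hπ]
      simp only [E, dif_pos hπ]
      exact hζ _
    · obtain ⟨x, hx, hm⟩ := hZ π (List.mem_finRange π)
      exact ⟨x, hx, hm, fun h => absurd h hπ⟩
  choose x hx hmatch hxs using hwords
  have hexec := executable_combine (ψ := ψ) (s := fun t i => x i t) hmatch
  have hmem := hexec.mem_cyclesRemoved hB (hexec.mem_removeInfeasible
    (mem_combinedProduct (P := P) (s := fun t i => x i t) hx (trueAtoms_mem_language hA hψ)) k)
  refine hnot ?_
  have hproj := mem_projectUniversal hmn hmem
  convert hproj using 5 with t i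
  exact (congrFun (hxs (Fin.castLE hmn i) i.2) t).symm
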